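/- Let $n\ge 2$ and $d\ge 1$, and let $|\mathrm{GHZ}_d^n\rangle=\frac1{\sqrt d}\sum_{i=1}^{d}|i\rangle^{\otimes n}\in(\mathbb C^d)^{\otimes n}$ be the generalized GHZ state shared by $n$ parties, each holding one tensor factor. Let $g=\operatorname{diag}(g_1,\dots,g_d)$ and $h=\operatorname{diag}(h_1,\dots,h_d)$ be invertible complex diagonal matrices with $\operatorname{tr}(g^\dagger g)=\operatorname{tr}(h^\dagger h)$. Then the (normalized) pure state represented by $(\mathbb 1\otimes\cdots\otimes\mathbb 1\otimes g)\,|\mathrm{GHZ}_d^n\rangle$ can be converted deterministically into the one represented by $(\mathbb 1\otimes\cdots\otimes\mathbb 1\otimes h)\,|\mathrm{GHZ}_d^n\rangle$ by local operations of the $n$ parties and classical communication (LOCC, with finitely or infinitely many rounds) if and only if the vector $(|h_1|^2,\dots,|h_d|^2)$ majorizes $(|g_1|^2,\dots,|g_d|^2)$. Here a vector $a\in\mathbb R^d$ majorizes $b\in\mathbb R^d$ if $\sum_{i=1}^k a_i^{\downarrow}\ge\sum_{i=1}^k b_i^{\downarrow}$ for all $1\le k\le d$, with equality for $k=d$, where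 $\downarrow$ denotes the rearrangement in descending order. -/

import Mathlib

open scoped Matrix

namespace MultipartiteLOCC

/-- Vectors of `(ℂ^d)^{⊗ n}`, given by their coordinates in the computational basis
`|x_1 ... x_n⟩`. -/
abbrev Ket (n d : ℕ) : Type := (Fin n → Fin d) → ℂ

/-- Linear operators on `(ℂ^d)^{⊗ n}`, as matrices in the computational basis. -/
abbrev Op (n d : ℕ) : Type := Matrix (Fin n → Fin d) (Fin n → Fin d) ℂ

/-- Linear maps on the operators on `(ℂ^d)^{⊗ n}`. -/
abbrev SuperOp (n d : ℕ) : Type := Op n d →ₗ[ℂ] Op n d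

/-- The product operator `A_1 ⊗ ... ⊗ A_n`. -/
def tensorOp {n d : ℕ} (A : Fin n → Matrix (Fin d) (Fin d) ℂ) : Op n d :=
  Matrix.of fun x y => ∏ i, A i (x i) (y i)

/-- The operator that acts as `A` on party `k` and as the identity on all other parties. -/
def localOp {n d : ℕ} (k : Fin n) (A : Matrix (Fin d) (Fin d) ℂ) : Op n d :=
  tensorOp (Function.update (fun _ => 1) k A)

/-- The generalized GHZ state `d^{-1/2} ∑_i |i ... i⟩`. -/
noncomputable def ghz (n d : ℕ) : Ket n d :=
  (1 / (Real.sqrt d : ℂ)) • ∑ i : Fin d, Pi.single (fun _ => i) 1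

/-- The density operator `|ψ⟩⟨ψ| / ⟨ψ|ψ⟩` of the pure state represented by a nonzero vector. -/
noncomputable def pureState {n d : ℕ} (ψ : Ket n d) : Op n d :=
  (((∑ x, ‖ψ x‖ ^ 2 : ℝ) : ℂ))⁻¹ • Matrix.vecMulVec ψ (star ψ)

/-- The map `X ↦ ∑_a K_a X K_a†`. -/
noncomputable def krausMap {n d : ℕ} {ι : Type} [Fintype ι] (K : ι → Op n d) : SuperOp n d :=
  ∑ a, LinearMap.mulLeft ℂ (K a) ∘ₗ LinearMap.mulRight ℂ (K a)ᴴ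

/-- Complete positivity, as existence of a finite Kraus decomposition. -/
def IsCP {n d : ℕ} (E : SuperOp n d) : Prop :=
  ∃ (r : ℕ) (K : Fin r → Op n d), E = krausMap K

/-- Quantum instruments with finitely many outcomes: completely positive maps, one for each
outcome, whose sum preserves the trace. -/
structure Instrument (n d : ℕ) where
  outcomes : ℕ
  map : Fin outcomes → SuperOp n d
  cp : ∀ j, IsCP (map j)
  tp : ∀ X : Op n d, (∑ j, map j X).trace = X.trace

/-- The quantum channel obtained from an instrument by forgetting the outcome. -/
noncomputable def Instrument.channel {n d : ℕ} (J : Instrument n d) : SuperOp n d :=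
  ∑ j, J.map j

/-- The trivial instrument: one outcome, and nothing is done. -/
noncomputable def Instrument.trivial (n d : ℕ) : Instrument n d where
  outcomes := 1
  map := fun _ => LinearMap.id
  cp := fun _ => ⟨1, fun _ => 1, by ext1 X; simp [krausMap]⟩
  tp := fun X => by simp

/-- One-way local instruments. A party `k` applies a local instrument, and on outcome `j` every
other party `i` applies a local channel that may depend on `j`; the map for outcome `j` is the
tensor product over all parties. The family `K j i` lists the Kraus operators of the map that
party `i` applies on outcome `j` (a common length `r` is no restriction, as zeros may be added). -/
def Instrument.IsOneWayLocal {n d : ℕ} (J : Instrument n d) : Prop :=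
  ∃ (k : Fin n) (r : ℕ) (K : Fin J.outcomes → Fin n → Fin r → Matrix (Fin d) (Fin d) ℂ),
    (∑ j, ∑ a, (K j k a)ᴴ * K j k a = 1) ∧
    (∀ j, ∀ i, i ≠ k → ∑ a, (K j i a)ᴴ * K j i a = 1) ∧
    ∀ j, J.map j = krausMap fun α : Fin n → Fin r => tensorOp fun i => K j i (α i)

/-- `J'` is LOCC linked to `J`: after `J` one performs a one-way local instrument `L j`, which
(including the acting party) may depend on the outcome `j` of `J`, and then coarse-grains the
joint outcomes `(j, i)` by a map `f`. -/
def Instrument.IsLinkedTo {n d : ℕ} (J' J : Instrument n d) : Prop :=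
  ∃ L : Fin J.outcomes → Instrument n d, (∀ j, (L j).IsOneWayLocal) ∧
    ∃ f : (Σ j : Fin J.outcomes, Fin (L j).outcomes) → Fin J'.outcomes,
      ∀ c, J'.map c = ∑ p with f p = c, (L p.1).map p.2 ∘ₗ J.map p.1

/-- LOCC channels: limits of the channels of a (possibly never terminating) protocol
`J 0, J 1, ...`, in which every round extends the preceding ones by a one-way local instrument.
Protocols with finitely many rounds are those in which nothing is done from some round on.
As the space is finite-dimensional, pointwise convergence is convergence in any norm. -/
def IsLOCC {n d : ℕ} (E : SuperOp n d) : Prop :=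
  ∃ J : ℕ → Instrument n d, J 0 = Instrument.trivial n d ∧
    (∀ ν, (J (ν + 1)).IsLinkedTo (J ν)) ∧
    ∀ X : Op n d, Filter.Tendsto (fun ν => (J ν).channel X) Filter.atTop (nhds (E X))

/-- The pure state `ψ` can be converted (deterministically) into the pure state `φ` by LOCC. -/
def LOCCConvertible {n d : ℕ} (ψ φ : Ket n d) : Prop :=
  ∃ E : SuperOp n d, IsLOCC E ∧ E (pureState ψ) = pureState φ

/-- The entries of `a` in descending order. -/
noncomputable def sortDesc {m : ℕ} (a : Fin m → ℝ) : Fin m → ℝ :=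
  fun i => a (Tuple.sort a i.rev)

/-- `a` majorizes `b`. -/
def Majorizes {m : ℕ} (a b : Fin m → ℝ) : Prop :=
  (∀ k : Fin m, ∑ i ∈ Finset.Iic k, sortDesc b i ≤ ∑ i ∈ Finset.Iic k, sortDesc a i) ∧
    ∑ i, sortDesc a i = ∑ i, sortDesc b i

end MultipartiteLOCC

/-! Put ψ_g = ∑ g_i |i…i⟩ and N = ∑ |g_i|² = ∑ |h_i|². After rescaling, the question is whether an
LOCC channel E takes |ψ_g⟩⟨ψ_g| to |ψ_h⟩⟨ψ_h|.

Necessity uses only that E is a limit of trace-preserving maps with product Kraus operators. The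
form D(x) = N‖x‖² − ⟨ψ_h|E(|x⟩⟨x|)|ψ_h⟩ is nonnegative and vanishes at ψ_g, hence is invariant under
translation by ψ_g (`IsLOCC.overlap_defect_add`). Let x be the part of ψ_g on an index set S, and s
= ‖x‖². The component of x orthogonal to ψ_g has squared norm s − s²/N, so D(x) ≤ Ns − s²: the
overlap is at least s². But x has Schmidt rank at most |S| between the first party and the rest, and
product operators do not raise it, so the overlap is at most s times the sum of the |S| largest
|h_i|² (`norm_dotProduct_tensorOp_sq_le`). Hence s is at most that sum.

Sufficiency takes one round. Majorization gives |g_i|² = ∑_σ p_σ |h_{σ(i)}|²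
(`Majorizes.exists_convex_combination`). One party measures with diagonal weights √p_σ h_{σ(i)}/g_i,
everyone relabels the basis by σ, and every outcome leaves a multiple of ψ_h. -/

namespace MultipartiteLOCC

/-! ### Rearrangements and majorization -/

/-- The permutation that puts the entries of `a` in descending order. -/
noncomputable def descPerm {m : ℕ} (a : Fin m → ℝ) : Equiv.Perm (Fin m) :=
  Fin.revPerm.trans (Tuple.sort a)

lemma sortDesc_eq_comp_descPerm {m : ℕ} (a : Fin m → ℝ) : sortDesc a = a ∘ descPerm a := rfl

lemma antitone_sortDesc {m : ℕ} (a : Fin m → ℝ) : Antitone (sortDesc a) := fun _ _ hij =>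
  Tuple.monotone_sort a (Fin.rev_le_rev.2 hij)

lemma sum_sortDesc {m : ℕ} (a : Fin m → ℝ) : ∑ i, sortDesc a i = ∑ i, a i :=
  Equiv.sum_comp (descPerm a) a

/-- Abel summation. The total of `D` is left free so that the induction can drop the last index. -/
lemma last_mul_sum_le_sum_mul {m : ℕ} (c D : Fin (m + 1) → ℝ) (hc : Antitone c)
    (hD : ∀ k, 0 ≤ ∑ i ∈ Finset.Iic k, D i) :
    c (Fin.last m) * ∑ i, D i ≤ ∑ i, c i * D i := by
  induction m with
  | zero => simp
  | succ m ih =>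
    have key : ∀ k : Fin (m + 1), ∑ i ∈ Finset.Iic k, D i.castSucc =
        ∑ i ∈ Finset.Iic k.castSucc, D i := fun k => by
      rw [← Fin.map_castSuccEmb_Iic, Finset.sum_map]; rfl
    have h := ih (fun i => c i.castSucc) (fun i => D i.castSucc)
      (fun i j hij => hc (Fin.castSucc_le_castSucc_iff.2 hij)) (fun k => by rw [key]; exact hD _)
    have h0 : 0 ≤ ∑ i : Fin (m + 1), D i.castSucc := by
      have := hD (Fin.last m).castSucc
      rw [← key, ← Fin.top_eq_last, Finset.Iic_top] at this
      exact this
    have h1 : c (Fin.last (m + 1)) ≤ c (Fin.last m).castSucc := hc (Fin.le_last _)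
    rw [Fin.sum_univ_castSucc, Fin.sum_univ_castSucc (fun i => c i * D i)]
    nlinarith [mul_le_mul_of_nonneg_right h1 h0]

lemma sum_mul_nonneg_of_antitone {m : ℕ} (c D : Fin m → ℝ) (hc : Antitone c)
    (hD : ∀ k, 0 ≤ ∑ i ∈ Finset.Iic k, D i) (h0 : ∑ i, D i = 0) : 0 ≤ ∑ i, c i * D i := by
  cases m with
  | zero => simp
  | succ m => simpa [h0] using last_mul_sum_le_sum_mul c D hc hD

lemma sum_mul_le_sum_sortDesc_mul {m : ℕ} (c b : Fin m → ℝ) :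
    ∑ i, c i * b i ≤ ∑ i, sortDesc c i * sortDesc b i := by
  have h : Monovary (sortDesc c) (sortDesc b) :=
    (antitone_sortDesc c).monovary (antitone_sortDesc b)
  have := h.sum_mul_comp_perm_le_sum_mul (σ := (descPerm c).trans (descPerm b).symm)
  refine le_trans (le_of_eq ?_) this
  rw [← Equiv.sum_comp (descPerm c)]
  simp [sortDesc_eq_comp_descPerm]

/-- Rearrange `a` into the same order as `c`; the rearrangement inequality and Abel summation do the
rest. This bounds every linear functional at `b` by its value at some rearrangement of `a`, as
separation requires. -/
lemma Majorizes.exists_sum_mul_le {m : ℕ} {a b : Fin m → ℝ} (hab : Majorizes a b)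
    (c : Fin m → ℝ) : ∃ σ : Equiv.Perm (Fin m), ∑ i, c i * b i ≤ ∑ i, c i * a (σ i) := by
  refine ⟨(descPerm c).symm.trans (descPerm a), ?_⟩
  have h1 := sum_mul_le_sum_sortDesc_mul c b
  have h2 := sum_mul_nonneg_of_antitone (sortDesc c) (fun i => sortDesc a i - sortDesc b i)
    (antitone_sortDesc c) (fun k => by
      rw [Finset.sum_sub_distrib, sub_nonneg]; exact hab.1 k)
    (by rw [Finset.sum_sub_distrib, sub_eq_zero]; exact hab.2)
  have h3 : ∑ i, c i * a ((descPerm c).symm.trans (descPerm a) i) =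
      ∑ i, sortDesc c i * sortDesc a i := by
    rw [← Equiv.sum_comp (descPerm c)]
    simp [sortDesc_eq_comp_descPerm]
  simp only [mul_sub, Finset.sum_sub_distrib] at h2
  linarith

/-- A vector majorized by `a` is a convex combination of the rearrangements of `a`. -/
lemma Majorizes.exists_convex_combination {m : ℕ} {a b : Fin m → ℝ} (hab : Majorizes a b) :
    ∃ p : Equiv.Perm (Fin m) → ℝ, (∀ σ, 0 ≤ p σ) ∧ ∀ i, b i = ∑ σ, p σ * a (σ i) := by
  let T : (Equiv.Perm (Fin m) → ℝ) →ₗ[ℝ] (Fin m → ℝ) :=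
    LinearMap.pi fun i => ∑ σ, a (σ i) • LinearMap.proj σ
  have hT : ∀ p i, T p i = ∑ σ, p σ * a (σ i) := fun p i => by simp [T, mul_comm]
  by_cases hb : b ∈ T '' stdSimplex ℝ (Equiv.Perm (Fin m))
  · obtain ⟨p, hp, rfl⟩ := hb
    exact ⟨p, hp.1, fun i => hT p i⟩
  · exfalso
    have hcomp : IsCompact (T '' stdSimplex ℝ (Equiv.Perm (Fin m))) :=
      (isCompact_stdSimplex ℝ _).image T.continuous_of_finiteDimensional
    -- A functional separating `b` from the hull of the rearrangements of `a` would exceed at `b`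
    -- its values at all of them.
    obtain ⟨f, u, hf1, hf2⟩ := geometric_hahn_banach_closed_point
      ((convex_stdSimplex ℝ (Equiv.Perm (Fin m))).linear_image T) hcomp.isClosed hb
    have hf : ∀ v : Fin m → ℝ, f v = ∑ i, f (Pi.single i 1) * v i := fun v => by
      have := f.toLinearMap.pi_apply_eq_sum_univ v
      simp only [smul_eq_mul] at this
      refine this.trans (Finset.sum_congr rfl fun i _ => ?_)
      have : (fun j => if i = j then (1 : ℝ) else 0) = Pi.single i 1 := by
        ext j
        simp [Pi.single_apply, eq_comm]
      rw [mul_comm, this]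
      rfl
    obtain ⟨σ, hσ⟩ := hab.exists_sum_mul_le fun i => f (Pi.single i 1)
    have h1 := hf1 _ ⟨Pi.single σ 1, single_mem_stdSimplex ℝ σ, rfl⟩
    have h2 : T (Pi.single σ 1) = fun i => a (σ i) := by
      ext i; rw [hT]; simp [Pi.single_apply]
    rw [h2, hf] at h1
    rw [hf b] at hf2
    linarith

/-- Fractional knapsack with threshold `c`, the (k+1)-st largest weight: (w_i − c) t_i is at most
the positive part of w_i − c, and c ∑ t_i ≤ (k+1) c because c ≥ 0. -/
lemma sum_mul_le_sum_Iic_sortDesc {m : ℕ} (w t : Fin m → ℝ) (k : Fin m) (hw : ∀ i, 0 ≤ w i)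
    (ht0 : ∀ i, 0 ≤ t i) (ht1 : ∀ i, t i ≤ 1) (ht : ∑ i, t i ≤ (k : ℕ) + 1) :
    ∑ i, w i * t i ≤ ∑ i ∈ Finset.Iic k, sortDesc w i := by
  set c := sortDesc w k
  have hc : 0 ≤ c := hw _
  have hle : ∀ i, sortDesc w i * t (descPerm w i) ≤
      c * t (descPerm w i) + if i ∈ Finset.Iic k then sortDesc w i - c else 0 := fun i => by
    have h0 := ht0 (descPerm w i)
    have h1 := ht1 (descPerm w i)
    split_ifs with hi
    · have : c ≤ sortDesc w i := antitone_sortDesc w (Finset.mem_Iic.1 hi)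
      nlinarith
    · have : sortDesc w i ≤ c := antitone_sortDesc w (le_of_lt (by simpa using hi))
      nlinarith
  calc ∑ i, w i * t i = ∑ i, sortDesc w i * t (descPerm w i) :=
        (Equiv.sum_comp (descPerm w) fun i => w i * t i).symm
    _ ≤ ∑ i, (c * t (descPerm w i) + if i ∈ Finset.Iic k then sortDesc w i - c else 0) :=
        Finset.sum_le_sum fun i _ => hle i
    _ = c * ∑ i, t i + (∑ i ∈ Finset.Iic k, sortDesc w i - ((k : ℕ) + 1) * c) := by
        rw [Finset.sum_add_distrib, ← Finset.mul_sum, Equiv.sum_comp (descPerm w) t,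
          Finset.sum_ite_mem, Finset.univ_inter, Finset.sum_sub_distrib]
        simp
    _ ≤ _ := by nlinarith

/-! ### Product operators and diagonal kets -/

lemma tensorOp_mul {n d : ℕ} (A B : Fin n → Matrix (Fin d) (Fin d) ℂ) :
    tensorOp A * tensorOp B = tensorOp fun i => A i * B i := by
  ext x y
  simp only [tensorOp, Matrix.mul_apply, Matrix.of_apply, Finset.prod_univ_sum,
    Fintype.piFinset_univ, Finset.prod_mul_distrib]

lemma tensorOp_conjTranspose {n d : ℕ} (A : Fin n → Matrix (Fin d) (Fin d) ℂ) :
    (tensorOp A)ᴴ = tensorOp fun i => (A i)ᴴ := by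
  ext x y
  simp [tensorOp]

lemma tensorOp_diagonal {n d : ℕ} (c : Fin n → Fin d → ℂ) :
    (tensorOp fun i => Matrix.diagonal (c i)) = Matrix.diagonal fun x => ∏ i, c i (x i) := by
  ext x y
  simp only [tensorOp, Matrix.of_apply, Matrix.diagonal_apply]
  rw [Finset.prod_ite_zero]
  simp [funext_iff]

lemma tensorOp_one {n d : ℕ} :
    (tensorOp fun _ : Fin n => (1 : Matrix (Fin d) (Fin d) ℂ)) = 1 := by
  simpa using tensorOp_diagonal fun (_ : Fin n) (_ : Fin d) => (1 : ℂ)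

lemma localOp_diagonal {n d : ℕ} (k : Fin n) (g : Fin d → ℂ) :
    localOp k (Matrix.diagonal g) = Matrix.diagonal fun x => g (x k) := by
  have : Function.update (fun _ => 1) k (Matrix.diagonal g) =
      fun i => Matrix.diagonal (if i = k then g else 1) := by
    ext1 i
    by_cases h : i = k
    · subst h; simp
    · simp [h]
  rw [localOp, this, tensorOp_diagonal]
  congr 1
  ext x
  rw [Finset.prod_eq_single k] <;> simp +contextual

/-- The vector `∑_i g_i |i ... i⟩`. -/
noncomputable def diagKet (n : ℕ) {d : ℕ} (g : Fin d → ℂ) : Ket n d :=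
  ∑ i, Pi.single (fun _ => i) (g i)

lemma localOp_diagonal_mulVec_ghz {n d : ℕ} (k : Fin n) (g : Fin d → ℂ) :
    localOp k (Matrix.diagonal g) *ᵥ ghz n d = (1 / (Real.sqrt d : ℂ)) • diagKet n g := by
  rw [localOp_diagonal, ghz, Matrix.mulVec_smul, Matrix.mulVec_sum, diagKet]
  simp

lemma dotProduct_diagKet {n d : ℕ} (v : Ket n d) (g : Fin d → ℂ) :
    v ⬝ᵥ diagKet n g = ∑ i, v (fun _ => i) * g i := by
  simp [diagKet, dotProduct_sum]

lemma star_diagKet {n d : ℕ} (g : Fin d → ℂ) : star (diagKet n g) = diagKet n (star g) := by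
  simp [diagKet, star_sum]

lemma diagKet_apply_const {n d : ℕ} (hn : 0 < n) (g : Fin d → ℂ) (i : Fin d) :
    diagKet n g (fun _ => i) = g i := by
  rw [diagKet, Finset.sum_apply, Finset.sum_eq_single i]
  · simp
  · intro j _ hj
    rw [Pi.single_apply, if_neg]
    intro h
    exact hj (congrFun h ⟨0, hn⟩).symm
  · simp

/-- The squared norm of a vector. -/
noncomputable def normSqKet {n d : ℕ} (x : Ket n d) : ℝ := ∑ i, ‖x i‖ ^ 2

lemma dotProduct_star_self {n d : ℕ} (x : Ket n d) : x ⬝ᵥ star x = (normSqKet x : ℂ) := by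
  simp [normSqKet, dotProduct, Complex.mul_conj']

lemma normSqKet_diagKet {n d : ℕ} (hn : 0 < n) (g : Fin d → ℂ) :
    normSqKet (diagKet n g) = ∑ i, ‖g i‖ ^ 2 := by
  have := dotProduct_star_self (diagKet n g)
  rw [dotProduct_comm, dotProduct_diagKet] at this
  simp only [Pi.star_apply, diagKet_apply_const hn] at this
  rw [← Complex.ofReal_inj, ← this]
  simp [Complex.conj_mul']

lemma normSqKet_smul {n d : ℕ} (c : ℂ) (x : Ket n d) :
    normSqKet (c • x) = ‖c‖ ^ 2 * normSqKet x := by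
  simp [normSqKet, mul_pow, Finset.mul_sum]

lemma vecMulVec_smul_star_smul {n d : ℕ} (c : ℂ) (x : Ket n d) :
    Matrix.vecMulVec (c • x) (star (c • x)) =
      ((‖c‖ ^ 2 : ℝ) : ℂ) • Matrix.vecMulVec x (star x) := by
  ext i j
  simp only [Matrix.vecMulVec_apply, Pi.smul_apply, Pi.star_apply, smul_eq_mul, star_mul',
    Matrix.smul_apply]
  push_cast
  rw [← Complex.mul_conj']
  simp only [RCLike.star_def]
  ring

lemma pureState_smul {n d : ℕ} (c : ℂ) (hc : c ≠ 0) (x : Ket n d) :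
    pureState (c • x) = pureState x := by
  have h := normSqKet_smul c x
  unfold normSqKet at h
  rw [pureState, pureState, vecMulVec_smul_star_smul, smul_smul, h]
  congr 1
  have : ((‖c‖ ^ 2 : ℝ) : ℂ) ≠ 0 := by simpa using hc
  rw [Complex.ofReal_mul, mul_inv, mul_right_comm, inv_mul_cancel₀ this, one_mul]

lemma pureState_localOp_mulVec_ghz {n d : ℕ} (hn : 0 < n) (hd : 1 ≤ d) (k : Fin n)
    (g : Fin d → ℂ) :
    pureState (localOp k (Matrix.diagonal g) *ᵥ ghz n d) =
      (((∑ i, ‖g i‖ ^ 2 : ℝ) : ℂ))⁻¹ •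
        Matrix.vecMulVec (diagKet n g) (star (diagKet n g)) := by
  rw [localOp_diagonal_mulVec_ghz, pureState_smul, pureState, ← normSqKet_diagKet hn g, normSqKet]
  simp
  omega

/-! ### Overlaps of product operators with diagonal kets -/

/-- Both sides are the trace of the projection onto `U`. -/
lemma sum_norm_starProjection_sq {d : ℕ} (U : Submodule ℂ (EuclideanSpace ℂ (Fin d))) :
    ∑ j, ‖U.starProjection (EuclideanSpace.single j 1)‖ ^ 2 = Module.finrank ℂ U := by
  let b := stdOrthonormalBasis ℂ U
  have h1 : ∀ j, ‖U.starProjection (EuclideanSpace.single j (1 : ℂ))‖ ^ 2 =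
      ∑ l, ‖(b l : EuclideanSpace ℂ (Fin d)) j‖ ^ 2 := fun j => by
    rw [Submodule.starProjection_apply, ← Submodule.coe_norm, ← b.sum_sq_norm_inner_right]
    refine Finset.sum_congr rfl fun l _ => ?_
    rw [Submodule.coe_inner, ← Submodule.starProjection_apply,
      ← Submodule.inner_starProjection_left_eq_right,
      Submodule.starProjection_eq_self_iff.2 (b l).2, EuclideanSpace.inner_single_right]
    simp
  simp only [h1]
  rw [Finset.sum_comm]
  have h2 : ∀ l, ∑ j, ‖(b l : EuclideanSpace ℂ (Fin d)) j‖ ^ 2 = 1 := fun l => by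
    rw [← EuclideanSpace.norm_sq_eq, ← Submodule.coe_norm, b.orthonormal.1 l, one_pow]
  simp [h2]

/-- A family of vectors `v j` in a subspace of dimension at most `k + 1` has overlap with
`∑ j, h j • e j ⊗ e j` bounded by the sum of the `k + 1` largest `‖h j‖ ^ 2`. -/
lemma norm_sum_sq_le_of_mem_submodule {d : ℕ} (U : Submodule ℂ (EuclideanSpace ℂ (Fin d)))
    (k : Fin d) (hU : Module.finrank ℂ U ≤ (k : ℕ) + 1) (h : Fin d → ℂ)
    (v : Fin d → EuclideanSpace ℂ (Fin d)) (hv : ∀ j, v j ∈ U) :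
    ‖∑ j, star (h j) * v j j‖ ^ 2 ≤
      (∑ i ∈ Finset.Iic k, sortDesc (fun i => ‖h i‖ ^ 2) i) * ∑ j, ‖v j‖ ^ 2 := by
  set t : Fin d → ℝ := fun j => ‖U.starProjection (EuclideanSpace.single j (1 : ℂ))‖
  have h1 : ∀ j, ‖star (h j) * v j j‖ ≤ (‖h j‖ * t j) * ‖v j‖ := fun j => by
    have : v j j = inner ℂ (U.starProjection (EuclideanSpace.single j (1 : ℂ))) (v j) := by
      rw [Submodule.inner_starProjection_left_eq_right,
        Submodule.starProjection_eq_self_iff.2 (hv j), EuclideanSpace.inner_single_left]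
      simp
    rw [norm_mul, norm_star, this, mul_assoc]
    exact mul_le_mul_of_nonneg_left (norm_inner_le_norm _ _) (norm_nonneg _)
  have ht1 : ∀ j, t j ≤ 1 := fun j => by
    simpa using U.norm_starProjection_apply_le (EuclideanSpace.single j (1 : ℂ))
  calc ‖∑ j, star (h j) * v j j‖ ^ 2 ≤ (∑ j, (‖h j‖ * t j) * ‖v j‖) ^ 2 := by
        gcongr
        exact (norm_sum_le _ _).trans (Finset.sum_le_sum fun j _ => h1 j)
    _ ≤ (∑ j, (‖h j‖ * t j) ^ 2) * ∑ j, ‖v j‖ ^ 2 := Finset.sum_mul_sq_le_sq_mul_sq _ _ _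
    _ ≤ _ := by
        gcongr
        simp only [mul_pow]
        refine sum_mul_le_sum_Iic_sortDesc _ _ k (fun i => by positivity) (fun i => by positivity)
          (fun i => pow_le_one₀ (norm_nonneg _) (ht1 i)) ?_
        rw [sum_norm_starProjection_sq]
        exact_mod_cast hU

lemma tensorOp_mulVec_diagKet {n d : ℕ} (A : Fin n → Matrix (Fin d) (Fin d) ℂ) (g : Fin d → ℂ)
    (x : Fin n → Fin d) : (tensorOp A *ᵥ diagKet n g) x = ∑ i, (∏ l, A l (x l) i) * g i :=
  dotProduct_diagKet _ _

/-- The second party's entry still records `j` after the first is overwritten, so the index tuples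
are distinct; this needs two parties. -/
lemma sum_update_const_le {n d : ℕ} (hn : 2 ≤ n) (f : (Fin n → Fin d) → ℝ) (hf : ∀ x, 0 ≤ f x) :
    ∑ j : Fin d, ∑ a : Fin d, f (Function.update (fun _ => j) ⟨0, by omega⟩ a) ≤ ∑ x, f x := by
  rw [← Fintype.sum_prod_type']
  have hinj : Function.Injective fun p : Fin d × Fin d =>
      (Function.update (fun _ => p.1) ⟨0, by omega⟩ p.2 : Fin n → Fin d) := by
    rintro ⟨j, a⟩ ⟨j', a'⟩ h
    have h0 := congrFun h ⟨0, by omega⟩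
    have h1 := congrFun h ⟨1, by omega⟩
    simp at h0 h1
    simp [h0, h1]
  rw [← Finset.sum_image (f := f) (s := Finset.univ) (g := fun p : Fin d × Fin d =>
      (Function.update (fun _ => p.1) ⟨0, by omega⟩ p.2 : Fin n → Fin d)) hinj.injOn]
  exact Finset.sum_le_sum_of_subset_of_nonneg (Finset.subset_univ _) fun x _ _ => hf x

/-- With `c` supported on `S`, the first party's factor of the image stays in the span of the
columns of `A z` indexed by `S`, a space of dimension at most k+1. -/
lemma norm_dotProduct_tensorOp_sq_le {n d : ℕ} (hn : 2 ≤ n)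
    (A : Fin n → Matrix (Fin d) (Fin d) ℂ) (h c : Fin d → ℂ) (k : Fin d) (S : Finset (Fin d))
    (hS : S.card ≤ (k : ℕ) + 1) (hc : ∀ i ∉ S, c i = 0) :
    ‖star (diagKet n h) ⬝ᵥ (tensorOp A *ᵥ diagKet n c)‖ ^ 2 ≤
      (∑ i ∈ Finset.Iic k, sortDesc (fun i => ‖h i‖ ^ 2) i) *
        normSqKet (tensorOp A *ᵥ diagKet n c) := by
  set z : Fin n := ⟨0, by omega⟩
  set y := tensorOp A *ᵥ diagKet n c
  let u : Fin d → EuclideanSpace ℂ (Fin d) := fun i => WithLp.toLp 2 fun a => A z a i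
  let U : Submodule ℂ (EuclideanSpace ℂ (Fin d)) := Submodule.span ℂ (S.image u : Finset _)
  have hU : Module.finrank ℂ U ≤ (k : ℕ) + 1 :=
    (finrank_span_finset_le_card _).trans (Finset.card_image_le.trans hS)
  -- The slice of `y` in which all other parties read `j`; only its entry at `j` meets the ket of
  -- `h`.
  let v : Fin d → EuclideanSpace ℂ (Fin d) := fun j =>
    WithLp.toLp 2 fun a => y (Function.update (fun _ => j) z a)
  have hv : ∀ j, v j ∈ U := fun j => by
    have : v j = ∑ i ∈ S, ((∏ l ∈ Finset.univ.erase z, A l j i) * c i) • u i := by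
      ext a
      simp only [v, y, tensorOp_mulVec_diagKet]
      rw [← Finset.sum_subset (Finset.subset_univ S) fun i _ hi => by rw [hc i hi, mul_zero]]
      simp only [WithLp.ofLp_sum, WithLp.ofLp_smul, Finset.sum_apply, Pi.smul_apply, smul_eq_mul, u]
      refine Finset.sum_congr rfl fun i _ => ?_
      rw [← Finset.mul_prod_erase _ _ (Finset.mem_univ z), Function.update_self,
        Finset.prod_congr rfl fun l hl => by
          rw [Function.update_of_ne (Finset.ne_of_mem_erase hl)]]
      ring
    rw [this]
    exact Submodule.sum_mem _ fun i hi => Submodule.smul_mem _ _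
      (Submodule.subset_span (by simpa using ⟨i, hi, rfl⟩))
  have h1 := norm_sum_sq_le_of_mem_submodule U k hU h v hv
  have h2 : star (diagKet n h) ⬝ᵥ y = ∑ j, star (h j) * v j j := by
    rw [star_diagKet, dotProduct_comm, dotProduct_diagKet]
    refine Finset.sum_congr rfl fun j _ => ?_
    have : Function.update (fun _ => j) z j = fun _ : Fin n => j := Function.update_eq_self _ _
    simp only [v, this, Pi.star_apply, mul_comm]
  have h3 : ∑ j, ‖v j‖ ^ 2 ≤ normSqKet y := by
    simp only [EuclideanSpace.norm_sq_eq]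
    exact sum_update_const_le hn (fun x => ‖y x‖ ^ 2) fun x => by positivity
  rw [h2]
  refine h1.trans (mul_le_mul_of_nonneg_left h3 ?_)
  exact Finset.sum_nonneg fun i _ => by rw [sortDesc]; positivity

/-! ### Separable maps -/

/-- The additive monoid of maps `X ↦ ∑_a K_a X K_a†` with product operators `K_a`. -/
def separableMaps (n d : ℕ) : AddSubmonoid (SuperOp n d) :=
  AddSubmonoid.closure (Set.range fun A : Fin n → Matrix (Fin d) (Fin d) ℂ =>
    LinearMap.mulLeft ℂ (tensorOp A) ∘ₗ LinearMap.mulRight ℂ (tensorOp A)ᴴ)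

lemma krausMap_tensorOp_mem_separableMaps {n d : ℕ} {ι : Type} [Fintype ι]
    (A : ι → Fin n → Matrix (Fin d) (Fin d) ℂ) :
    krausMap (fun a => tensorOp (A a)) ∈ separableMaps n d :=
  AddSubmonoid.sum_mem _ fun a _ => AddSubmonoid.subset_closure ⟨A a, rfl⟩

lemma comp_mem_separableMaps {n d : ℕ} {E F : SuperOp n d} (hE : E ∈ separableMaps n d)
    (hF : F ∈ separableMaps n d) : E ∘ₗ F ∈ separableMaps n d := by
  induction hE using AddSubmonoid.closure_induction with
  | zero => rw [LinearMap.zero_comp]; exact zero_mem _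
  | add E E' _ _ h h' => rw [LinearMap.add_comp]; exact add_mem h h'
  | mem E hE =>
    obtain ⟨A, rfl⟩ := hE
    induction hF using AddSubmonoid.closure_induction with
    | zero => rw [LinearMap.comp_zero]; exact zero_mem _
    | add F F' _ _ h h' => rw [LinearMap.comp_add]; exact add_mem h h'
    | mem F hF =>
      obtain ⟨B, rfl⟩ := hF
      refine AddSubmonoid.subset_closure ⟨fun i => A i * B i, ?_⟩
      ext1 X
      simp [← tensorOp_mul, Matrix.conjTranspose_mul, Matrix.mul_assoc]

lemma Instrument.IsOneWayLocal.map_mem_separableMaps {n d : ℕ} {J : Instrument n d}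
    (hJ : J.IsOneWayLocal) (j : Fin J.outcomes) : J.map j ∈ separableMaps n d := by
  obtain ⟨k, r, K, -, -, h⟩ := hJ
  rw [h j]
  exact krausMap_tensorOp_mem_separableMaps _

lemma Instrument.IsLinkedTo.map_mem_separableMaps {n d : ℕ} {J' J : Instrument n d}
    (h : J'.IsLinkedTo J) (hJ : ∀ j, J.map j ∈ separableMaps n d) (c : Fin J'.outcomes) :
    J'.map c ∈ separableMaps n d := by
  obtain ⟨L, hL, f, hf⟩ := h
  rw [hf]
  exact AddSubmonoid.sum_mem _ fun p _ =>
    comp_mem_separableMaps ((hL p.1).map_mem_separableMaps p.2) (hJ p.1)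

lemma id_mem_separableMaps {n d : ℕ} : LinearMap.id ∈ separableMaps n d := by
  refine AddSubmonoid.subset_closure ⟨fun _ => 1, ?_⟩
  ext1 X
  simp [tensorOp_one]

/-- Product Kraus operators survive composition and coarse-graining, so every finite stage is
separable. Separability of the limit is not needed: only closed inequalities are passed to it. -/
lemma channel_mem_separableMaps {n d : ℕ} {J : ℕ → Instrument n d}
    (h0 : J 0 = Instrument.trivial n d) (hJ : ∀ ν, (J (ν + 1)).IsLinkedTo (J ν)) (ν : ℕ) :
    (J ν).channel ∈ separableMaps n d := by
  suffices ∀ ν, ∀ j, (J ν).map j ∈ separableMaps n d from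
    AddSubmonoid.sum_mem _ fun j _ => this ν j
  intro ν
  induction ν with
  | zero => rw [h0]; exact fun _ => id_mem_separableMaps
  | succ ν ih => exact (hJ ν).map_mem_separableMaps ih

/-! ### Overlap bounds for LOCC channels -/

/-- The real number `⟨y| E(|x⟩⟨x|) |y⟩`. -/
noncomputable def overlap {n d : ℕ} (E : SuperOp n d) (y x : Ket n d) : ℝ :=
  (star y ⬝ᵥ (E (Matrix.vecMulVec x (star x)) *ᵥ y)).re

lemma mul_vecMulVec_mul_conjTranspose {n d : ℕ} (A : Op n d) (x : Ket n d) :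
    A * (Matrix.vecMulVec x (star x) * Aᴴ) = Matrix.vecMulVec (A *ᵥ x) (star (A *ᵥ x)) := by
  rw [Matrix.vecMulVec_mul, Matrix.mul_vecMulVec, Matrix.star_mulVec]

lemma star_dotProduct_vecMulVec_mulVec_re {n d : ℕ} (x y : Ket n d) :
    (star y ⬝ᵥ (Matrix.vecMulVec x (star x) *ᵥ y)).re = ‖star y ⬝ᵥ x‖ ^ 2 := by
  rw [Matrix.vecMulVec_mulVec, dotProduct_smul, op_smul_eq_mul, Matrix.star_dotProduct x y,
    RCLike.star_def, Complex.mul_conj']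
  norm_cast

lemma norm_star_dotProduct_sq_le {n d : ℕ} (x y : Ket n d) :
    ‖star y ⬝ᵥ x‖ ^ 2 ≤ normSqKet y * normSqKet x := by
  calc ‖star y ⬝ᵥ x‖ ^ 2 ≤ (∑ i, ‖y i‖ * ‖x i‖) ^ 2 := by
        gcongr
        refine (norm_sum_le _ _).trans_eq ?_
        simp
    _ ≤ _ := Finset.sum_mul_sq_le_sq_mul_sq _ _ _

lemma trace_vecMulVec_star {n d : ℕ} (x : Ket n d) :
    (Matrix.vecMulVec x (star x)).trace = (normSqKet x : ℂ) := by
  rw [Matrix.trace_vecMulVec, dotProduct_star_self]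

/-- Both sides are additive in `E`, so one product Kraus operator suffices. The constants may have
any sign, so lower bounds on the overlap are covered too. -/
lemma separableMaps_overlap_induction {n d : ℕ} {E : SuperOp n d} (hE : E ∈ separableMaps n d)
    (c c' : ℝ) (y x : Ket n d)
    (h : ∀ A : Fin n → Matrix (Fin d) (Fin d) ℂ,
      c * ‖star y ⬝ᵥ (tensorOp A *ᵥ x)‖ ^ 2 ≤ c' * normSqKet (tensorOp A *ᵥ x)) :
    c * overlap E y x ≤ c' * (E (Matrix.vecMulVec x (star x))).trace.re := by
  induction hE using AddSubmonoid.closure_induction with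
  | zero => simp [overlap]
  | add E E' _ _ h h' =>
    simp only [overlap, LinearMap.add_apply, Matrix.add_mulVec, dotProduct_add, Complex.add_re,
      Matrix.trace_add, mul_add] at h h' ⊢
    exact add_le_add h h'
  | mem E hE =>
    obtain ⟨A, rfl⟩ := hE
    simp only [overlap, LinearMap.comp_apply, LinearMap.mulLeft_apply, LinearMap.mulRight_apply,
      mul_vecMulVec_mul_conjTranspose, star_dotProduct_vecMulVec_mulVec_re, trace_vecMulVec_star,
      Complex.ofReal_re]
    exact h A

lemma Instrument.trace_channel {n d : ℕ} (J : Instrument n d) (X : Op n d) :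
    (J.channel X).trace = X.trace := by
  simpa [Instrument.channel] using J.tp X

/-- Linear bounds on overlaps under product operators extend to all LOCC channels. -/
lemma IsLOCC.mul_overlap_le {n d : ℕ} {E : SuperOp n d} (hE : IsLOCC E)
    (c c' : ℝ) (y x : Ket n d)
    (h : ∀ A : Fin n → Matrix (Fin d) (Fin d) ℂ,
      c * ‖star y ⬝ᵥ (tensorOp A *ᵥ x)‖ ^ 2 ≤ c' * normSqKet (tensorOp A *ᵥ x)) :
    c * overlap E y x ≤ c' * normSqKet x := by
  obtain ⟨J, h0, hJ, hlim⟩ := hE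
  have hcont : Continuous fun Y : Op n d => c * (star y ⬝ᵥ (Y *ᵥ y)).re := by
    simp only [Matrix.mulVec, dotProduct]
    fun_prop
  have ht := (hcont.tendsto _).comp (hlim (Matrix.vecMulVec x (star x)))
  refine le_of_tendsto' ht fun ν => ?_
  have := separableMaps_overlap_induction (channel_mem_separableMaps h0 hJ ν) c c' y x h
  rwa [Instrument.trace_channel, trace_vecMulVec_star, Complex.ofReal_re] at this

lemma IsLOCC.overlap_nonneg {n d : ℕ} {E : SuperOp n d} (hE : IsLOCC E) (y x : Ket n d) :
    0 ≤ overlap E y x := by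
  have := hE.mul_overlap_le (-1) 0 y x fun A => by
    have := sq_nonneg ‖star y ⬝ᵥ (tensorOp A *ᵥ x)‖
    linarith
  linarith

lemma IsLOCC.overlap_le {n d : ℕ} {E : SuperOp n d} (hE : IsLOCC E) (y x : Ket n d) :
    overlap E y x ≤ normSqKet y * normSqKet x := by
  have := hE.mul_overlap_le 1 (normSqKet y) y x fun A => by
    rw [one_mul]
    exact norm_star_dotProduct_sq_le _ _
  linarith

lemma eq_zero_of_forall_add_mul_nonneg {a b : ℝ} (h : ∀ t : ℝ, 0 ≤ a + t * b) : b = 0 := by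
  by_contra hb
  have := h (-(a + 1) / b)
  rw [div_mul_cancel₀ _ hb] at this
  linarith

/-- If `E` maps `|ψ⟩⟨ψ|` to a state on which `|y⟩` attains the Cauchy-Schwarz bound, then the
defect of that bound is invariant under translation by `ψ`. -/
lemma IsLOCC.overlap_defect_add {n d : ℕ} {E : SuperOp n d} (hE : IsLOCC E) (y ψ x : Ket n d)
    (hψ : overlap E y ψ = normSqKet y * normSqKet ψ) (t : ℝ) :
    normSqKet y * normSqKet (x + (t : ℂ) • ψ) - overlap E y (x + (t : ℂ) • ψ) =
      normSqKet y * normSqKet x - overlap E y x := by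
  set V := Matrix.vecMulVec x (star ψ) + Matrix.vecMulVec ψ (star x)
  have hvec : ∀ t : ℝ, Matrix.vecMulVec (x + (t : ℂ) • ψ) (star (x + (t : ℂ) • ψ)) =
      Matrix.vecMulVec x (star x) + (t : ℂ) • V +
        ((t : ℂ) * t) • Matrix.vecMulVec ψ (star ψ) := fun t => by
    ext i j
    simp only [V, Matrix.vecMulVec_apply, Pi.add_apply, Pi.smul_apply, Pi.star_apply, star_add,
      star_smul, smul_eq_mul, Matrix.add_apply, Matrix.smul_apply, RCLike.star_def,
      Complex.conj_ofReal]
    ring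
  set b := normSqKet y * V.trace.re - (star y ⬝ᵥ (E V *ᵥ y)).re
  have hov : ∀ t : ℝ, overlap E y (x + (t : ℂ) • ψ) =
      overlap E y x + t * (star y ⬝ᵥ (E V *ᵥ y)).re + t * t * overlap E y ψ := fun t => by
    rw [overlap, hvec]
    simp [overlap, Matrix.add_mulVec, Matrix.smul_mulVec, dotProduct_add, dotProduct_smul]
  have hnorm : ∀ t : ℝ, normSqKet (x + (t : ℂ) • ψ) =
      normSqKet x + t * V.trace.re + t * t * normSqKet ψ := fun t => by
    have := congrArg Complex.re (trace_vecMulVec_star (x + (t : ℂ) • ψ))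
    rw [hvec, Complex.ofReal_re] at this
    rw [← this]
    simp [Matrix.trace_add, Matrix.trace_smul, dotProduct_star_self]
  have hdef : ∀ t : ℝ, normSqKet y * normSqKet (x + (t : ℂ) • ψ) - overlap E y (x + (t : ℂ) • ψ) =
      normSqKet y * normSqKet x - overlap E y x + t * b := fun t => by
    rw [hov, hnorm, hψ]
    ring
  -- By `hψ` the quadratic terms in `t` cancel, so the defect is affine in `t`; being nonnegative
  -- everywhere, it has slope `b` zero.
  have hb : b = 0 := eq_zero_of_forall_add_mul_nonneg fun t => by
    rw [← hdef]
    exact sub_nonneg.2 (hE.overlap_le _ _)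
  rw [hdef, hb, mul_zero, add_zero]

/-- Truncating a diagonal ket bounds the partial sums of its squared coefficients. -/
lemma IsLOCC.sum_norm_sq_le {n d : ℕ} (hn : 2 ≤ n) {E : SuperOp n d} (hE : IsLOCC E)
    (g h : Fin d → ℂ) (hgh : ∑ i, ‖g i‖ ^ 2 = ∑ i, ‖h i‖ ^ 2) (hpos : 0 < ∑ i, ‖h i‖ ^ 2)
    (hmap : E (Matrix.vecMulVec (diagKet n g) (star (diagKet n g))) =
      Matrix.vecMulVec (diagKet n h) (star (diagKet n h)))
    (k : Fin d) (S : Finset (Fin d)) (hS : S.card ≤ (k : ℕ) + 1) :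
    ∑ i ∈ S, ‖g i‖ ^ 2 ≤ ∑ i ∈ Finset.Iic k, sortDesc (fun i => ‖h i‖ ^ 2) i := by
  set N := ∑ i, ‖h i‖ ^ 2
  set s := ∑ i ∈ S, ‖g i‖ ^ 2
  set B := ∑ i ∈ Finset.Iic k, sortDesc (fun i => ‖h i‖ ^ 2) i
  have hB : 0 ≤ B := Finset.sum_nonneg fun i _ => by rw [sortDesc]; positivity
  have hs : 0 ≤ s := Finset.sum_nonneg fun i _ => by positivity
  have hn0 : 0 < n := by omega
  set y := diagKet n h
  have hy : normSqKet y = N := normSqKet_diagKet hn0 h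
  set c : Fin d → ℂ := fun i => if i ∈ S then g i else 0
  have hψ : overlap E y (diagKet n g) = normSqKet y * normSqKet (diagKet n g) := by
    rw [overlap, hmap, star_dotProduct_vecMulVec_mulVec_re, dotProduct_comm, dotProduct_star_self,
      normSqKet_diagKet hn0 g, hgh, hy, Complex.norm_real, Real.norm_eq_abs, sq_abs, sq]
  have hc : normSqKet (diagKet n c) = s := by
    rw [normSqKet_diagKet hn0, ← Finset.sum_subset (Finset.subset_univ S)
      fun i _ hi => by simp [c, hi]]
    exact Finset.sum_congr rfl fun i hi => by simp [c, hi]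
  -- The coefficient −s/N makes the sum orthogonal to the ket of `g`, since the inner product with
  -- the truncation is s and the squared norm is N.
  have hdiff : diagKet n c + ((-(s / N) : ℝ) : ℂ) • diagKet n g =
      diagKet n fun i => c i - (s / N : ℝ) * g i := by
    simp only [diagKet, Finset.smul_sum, ← Finset.sum_add_distrib]
    refine Finset.sum_congr rfl fun i _ => ?_
    rw [← Pi.single_smul, ← Pi.single_add]
    congr 1
    push_cast
    rw [smul_eq_mul]
    ring
  have hdn : normSqKet (diagKet n fun i => c i - (s / N : ℝ) * g i) = s - s ^ 2 / N := by
    have hterm : ∀ i, ‖c i - (s / N : ℝ) * g i‖ ^ 2 =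
        (1 - 2 * (s / N)) * ‖c i‖ ^ 2 + (s / N) ^ 2 * ‖g i‖ ^ 2 := fun i => by
      by_cases hi : i ∈ S
      · simp only [c, hi, if_true]
        rw [← one_sub_mul, norm_mul, mul_pow, ← Complex.ofReal_one, ← Complex.ofReal_sub,
          Complex.norm_real, Real.norm_eq_abs, sq_abs]
        ring
      · simp only [c, hi, if_false, zero_sub, norm_neg, norm_mul, mul_pow, Complex.norm_real,
          Real.norm_eq_abs, sq_abs, norm_zero]
        ring
    rw [normSqKet_diagKet hn0] at hc ⊢
    simp only [hterm]
    rw [Finset.sum_add_distrib, ← Finset.mul_sum, ← Finset.mul_sum, hc, hgh]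
    field_simp
    ring
  have h1 := hE.overlap_defect_add y (diagKet n g) (diagKet n c) hψ (-(s / N))
  rw [hdiff, hdn, hc, hy] at h1
  have h2 := hE.overlap_nonneg y (diagKet n fun i => c i - (s / N : ℝ) * g i)
  have h3 := hE.mul_overlap_le 1 B y (diagKet n c) fun A => by
    rw [one_mul]
    exact norm_dotProduct_tensorOp_sq_le hn A h c k S hS fun i hi => by simp [c, hi]
  rw [hc, one_mul] at h3
  have h4 : N * (s - s ^ 2 / N) = N * s - s ^ 2 := by field_simp
  -- The invariant defect and `h2` give overlap ≥ s², while `h3` gives overlap ≤ B s.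
  have h5 : s * s ≤ B * s := by nlinarith
  rcases hs.eq_or_lt with h0 | h0
  · rwa [← h0]
  · exact le_of_mul_le_mul_right h5 h0

/-! ### The conversion protocol -/

/-- The matrix `∑_i c_i |σ(i)⟩⟨i|`. -/
def permScale {d : ℕ} (σ : Equiv.Perm (Fin d)) (c : Fin d → ℂ) : Matrix (Fin d) (Fin d) ℂ :=
  Matrix.of fun a i => if a = σ i then c i else 0

lemma conjTranspose_permScale_mul {d : ℕ} (σ : Equiv.Perm (Fin d)) (c : Fin d → ℂ) :
    (permScale σ c)ᴴ * permScale σ c = Matrix.diagonal fun i => ((‖c i‖ ^ 2 : ℝ) : ℂ) := by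
  ext i j
  rw [Matrix.mul_apply, Finset.sum_eq_single (σ i)]
  · by_cases h : i = j
    · subst h; simp [permScale, Complex.conj_mul']
    · simp [permScale, h]
  · intro a _ ha
    simp [permScale, ha]
  · simp

lemma trace_krausMap_apply {n d : ℕ} {ι : Type} [Fintype ι] (K : ι → Op n d) (X : Op n d) :
    (krausMap K X).trace = ((∑ a, (K a)ᴴ * K a) * X).trace := by
  simp only [krausMap, LinearMap.sum_apply, LinearMap.comp_apply, LinearMap.mulLeft_apply,
    LinearMap.mulRight_apply, Matrix.trace_sum, Finset.sum_mul]
  refine Finset.sum_congr rfl fun a _ => ?_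
  rw [← Matrix.mul_assoc, Matrix.trace_mul_comm, ← Matrix.mul_assoc]

lemma krausMap_unique {n d : ℕ} {ι κ : Type} [Fintype ι] [Unique ι] [Fintype κ] [Unique κ]
    (A : Op n d) :
    krausMap (fun _ : ι => A) = krausMap fun _ : κ => A := by
  simp [krausMap]

/-- The measurement with outcomes `σ` in which party `k` applies `∑_i m_σ(i) |σ(i)⟩⟨i|` and all
others permute their basis by `σ`. -/
noncomputable def permInstrument {n d : ℕ} (k : Fin n) {N : ℕ} (σ : Fin N → Equiv.Perm (Fin d))
    (m : Fin N → Fin d → ℂ) (hm : ∀ i, ∑ j, ‖m j i‖ ^ 2 = 1) : Instrument n d where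
  outcomes := N
  -- One Kraus operator per outcome; this index type is the case r = 1 of
  -- `Instrument.IsOneWayLocal`, so that its last condition holds by `rfl`.
  map := fun j => krausMap fun _ : Fin n → Fin 1 =>
    tensorOp fun l => permScale (σ j) (if l = k then m j else 1)
  cp := fun j => ⟨1, fun _ => tensorOp fun l => permScale (σ j) (if l = k then m j else 1),
    krausMap_unique _⟩
  tp := fun X => by
    rw [Matrix.trace_sum]
    simp only [trace_krausMap_apply, Finset.univ_unique, Finset.sum_singleton,
      tensorOp_conjTranspose, tensorOp_mul, conjTranspose_permScale_mul]
    rw [← Matrix.trace_sum, ← Finset.sum_mul]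
    suffices ∑ j, tensorOp (fun l : Fin n => Matrix.diagonal fun i : Fin d =>
        ((‖(if l = k then m j else 1) i‖ ^ 2 : ℝ) : ℂ)) = 1 by rw [this, one_mul]
    have h : ∀ j, tensorOp (fun l : Fin n => Matrix.diagonal fun i : Fin d =>
        ((‖(if l = k then m j else 1) i‖ ^ 2 : ℝ) : ℂ)) =
        Matrix.diagonal fun x => ((‖m j (x k)‖ ^ 2 : ℝ) : ℂ) := fun j => by
      rw [tensorOp_diagonal]
      congr 1
      ext x
      rw [Finset.prod_eq_single k] <;> simp +contextual
    simp only [h]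
    ext x y
    rw [Matrix.sum_apply]
    by_cases hxy : x = y
    · subst hxy
      simp only [Matrix.diagonal_apply_eq, Matrix.one_apply_eq]
      exact_mod_cast hm (x k)
    · simp [hxy]

lemma permInstrument_isOneWayLocal {n d : ℕ} (k : Fin n) {N : ℕ}
    (σ : Fin N → Equiv.Perm (Fin d)) (m : Fin N → Fin d → ℂ) (hm : ∀ i, ∑ j, ‖m j i‖ ^ 2 = 1) :
    (permInstrument k σ m hm).IsOneWayLocal := by
  refine ⟨k, 1, fun j l _ => permScale (σ (j : Fin N)) (if l = k then m (j : Fin N) else 1),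
    ?_, ?_, fun _ => rfl⟩
  · simp only [Finset.univ_unique, Finset.sum_singleton, conjTranspose_permScale_mul, if_true]
    ext i i'
    refine (Matrix.sum_apply _ _ _ _).trans ?_
    by_cases h : i = i'
    · subst h
      simp only [Matrix.diagonal_apply_eq, Matrix.one_apply_eq]
      exact_mod_cast hm i
    · simp [h]
  · intro j l hl
    simp [hl, conjTranspose_permScale_mul]

lemma Instrument.sum_trivial_outcomes {n d : ℕ} {M : Type*} [AddCommMonoid M]
    (f : Fin (Instrument.trivial n d).outcomes → M) : ∑ j, f j = f ⟨0, Nat.one_pos⟩ :=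
  Fin.sum_univ_one f

lemma Instrument.trivial_isOneWayLocal {n d : ℕ} (hn : 0 < n) :
    (Instrument.trivial n d).IsOneWayLocal := by
  refine ⟨⟨0, hn⟩, 1, fun _ _ _ => 1, ?_, ?_, fun _ => ?_⟩
  · rw [Instrument.sum_trivial_outcomes]
    simp
  · simp
  · ext1 X
    simp [Instrument.trivial, krausMap, tensorOp_one]

lemma Instrument.isLinkedTo_self {n d : ℕ} (hn : 0 < n) (J : Instrument n d) :
    J.IsLinkedTo J := by
  refine ⟨fun _ => Instrument.trivial n d, fun _ => Instrument.trivial_isOneWayLocal hn,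
    fun p => p.1, fun c => ?_⟩
  rw [Finset.sum_filter, Fintype.sum_sigma, Finset.sum_eq_single c]
  · rw [Instrument.sum_trivial_outcomes, if_pos rfl]
    rfl
  · intro j _ hj
    simp [hj]
  · simp

lemma Instrument.IsOneWayLocal.isLinkedTo_trivial {n d : ℕ} {J : Instrument n d}
    (hJ : J.IsOneWayLocal) : J.IsLinkedTo (Instrument.trivial n d) := by
  refine ⟨fun _ => J, fun _ => hJ, fun p => p.2, fun c => ?_⟩
  rw [Finset.sum_filter, Fintype.sum_sigma, Instrument.sum_trivial_outcomes]
  simp [Instrument.trivial]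

/-- A single one-way local round followed by doing nothing is an LOCC channel. -/
lemma Instrument.IsOneWayLocal.isLOCC_channel {n d : ℕ} (hn : 0 < n) {J : Instrument n d}
    (hJ : J.IsOneWayLocal) : IsLOCC J.channel := by
  refine ⟨fun ν => Nat.casesOn ν (Instrument.trivial n d) fun _ => J, rfl, fun ν => ?_,
    fun X => ?_⟩
  · cases ν with
    | zero => exact hJ.isLinkedTo_trivial
    | succ ν => exact J.isLinkedTo_self hn
  · rw [← Filter.tendsto_add_atTop_iff_nat 1]
    exact tendsto_const_nhds

/-- The operator sends |i…i⟩ to m_i |σ(i)…σ(i)⟩, so the hypothesis makes the image proportional to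
the target after reindexing by `σ`. -/
lemma tensorOp_permScale_mulVec_diagKet {n d : ℕ} (k : Fin n) (σ : Equiv.Perm (Fin d))
    (m g h : Fin d → ℂ) (c : ℂ) (hmg : ∀ i, m i * g i = c * h (σ i)) :
    (tensorOp fun l => permScale σ (if l = k then m else 1)) *ᵥ diagKet n g =
      c • diagKet n h := by
  ext x
  rw [tensorOp_mulVec_diagKet, diagKet, Pi.smul_apply, Finset.sum_apply, smul_eq_mul,
    Finset.mul_sum]
  conv_rhs => rw [← Equiv.sum_comp σ]
  refine Finset.sum_congr rfl fun i _ => ?_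
  simp only [permScale, Matrix.of_apply]
  rw [Finset.prod_ite_zero, Pi.single_apply]
  by_cases hx : x = fun _ => σ i
  · subst hx
    rw [Finset.prod_eq_single k] <;> simp +contextual [hmg]
  · rw [if_neg hx, if_neg fun h => hx (funext fun l => h l (Finset.mem_univ l))]
    simp

lemma krausMap_vecMulVec {n d : ℕ} {ι : Type} [Fintype ι] (K : ι → Op n d) (x : Ket n d) :
    krausMap K (Matrix.vecMulVec x (star x)) =
      ∑ a, Matrix.vecMulVec (K a *ᵥ x) (star (K a *ᵥ x)) := by
  simp [krausMap, mul_vecMulVec_mul_conjTranspose]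

lemma exists_isLOCC_of_majorizes {n d : ℕ} (k : Fin n) (g h : Fin d → ℂ) (hg : ∀ i, g i ≠ 0)
    (hpos : ∑ i, ‖h i‖ ^ 2 ≠ 0)
    (hgh : ∑ i, ‖g i‖ ^ 2 = ∑ i, ‖h i‖ ^ 2)
    (hmaj : Majorizes (fun i => ‖h i‖ ^ 2) (fun i => ‖g i‖ ^ 2)) :
    ∃ E : SuperOp n d, IsLOCC E ∧
      E (Matrix.vecMulVec (diagKet n g) (star (diagKet n g))) =
        Matrix.vecMulVec (diagKet n h) (star (diagKet n h)) := by
  obtain ⟨p, hp0, hp⟩ := hmaj.exists_convex_combination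
  let e := (Fintype.equivFin (Equiv.Perm (Fin d))).symm
  -- Chosen so that m_σ(i) g_i = √p_σ h_{σ(i)}; the completeness relation is then exactly the
  -- expansion `hp` of |g_i|².
  let m : Fin (Fintype.card (Equiv.Perm (Fin d))) → Fin d → ℂ := fun j i =>
    (Real.sqrt (p (e j)) : ℂ) * h (e j i) / g i
  have hm : ∀ i, ∑ j, ‖m j i‖ ^ 2 = 1 := fun i => by
    have hgi : ‖g i‖ ^ 2 ≠ 0 := by simpa using hg i
    have : ∀ j, ‖m j i‖ ^ 2 = p (e j) * ‖h (e j i)‖ ^ 2 / ‖g i‖ ^ 2 := fun j => by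
      simp only [m, norm_div, norm_mul, Complex.norm_real, div_pow, mul_pow, Real.norm_eq_abs,
        sq_abs, Real.sq_sqrt (hp0 _)]
    simp only [this]
    rw [← Finset.sum_div, Equiv.sum_comp e fun σ => p σ * ‖h (σ i)‖ ^ 2, ← hp i, div_self hgi]
  -- Normalization of `p` is recovered by summing `hp` over `i` and comparing the equal, nonzero
  -- totals.
  have hsum : ∑ σ, p σ = 1 := by
    have h1 : ∑ i, ‖g i‖ ^ 2 = (∑ σ, p σ) * ∑ i, ‖h i‖ ^ 2 := by
      simp only [hp]
      rw [Finset.sum_comm, Finset.sum_mul]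
      refine Finset.sum_congr rfl fun σ _ => ?_
      rw [← Finset.mul_sum, Equiv.sum_comp σ fun i => ‖h i‖ ^ 2]
    rw [hgh] at h1
    exact (mul_eq_right₀ hpos).1 h1.symm
  refine ⟨(permInstrument k e m hm).channel,
    (permInstrument_isOneWayLocal k e m hm).isLOCC_channel k.pos, ?_⟩
  rw [Instrument.channel, LinearMap.sum_apply]
  simp only [permInstrument, krausMap_vecMulVec, Finset.univ_unique, Finset.sum_singleton]
  have : ∀ j, (tensorOp fun l => permScale (e j) (if l = k then m j else 1)) *ᵥ diagKet n g =
      (Real.sqrt (p (e j)) : ℂ) • diagKet n h := fun j =>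
    tensorOp_permScale_mulVec_diagKet k (e j) (m j) g h _ fun i => div_mul_cancel₀ _ (hg i)
  simp only [this, vecMulVec_smul_star_smul, Complex.norm_real, Real.norm_eq_abs, sq_abs,
    Real.sq_sqrt (hp0 _)]
  have hsum' : ∑ j, ((p (e j) : ℝ) : ℂ) = 1 := by
    rw [Equiv.sum_comp e fun σ => ((p σ : ℝ) : ℂ), ← Complex.ofReal_sum, hsum, Complex.ofReal_one]
  rw [← Finset.sum_smul]
  exact (congrArg (· • _) hsum').trans (one_smul _ _)

end MultipartiteLOCC

theorem theorem5 (n d : ℕ) (hn : 2 ≤ n) (hd : 1 ≤ d) (g h : Fin d → ℂ)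
    (hg : IsUnit (Matrix.diagonal g)) (hh : IsUnit (Matrix.diagonal h))
    (htr : ((Matrix.diagonal g)ᴴ * Matrix.diagonal g).trace =
      ((Matrix.diagonal h)ᴴ * Matrix.diagonal h).trace) :
    MultipartiteLOCC.LOCCConvertible
        ((MultipartiteLOCC.localOp (⟨n - 1, by omega⟩ : Fin n) (Matrix.diagonal g)) *ᵥ
          MultipartiteLOCC.ghz n d)
        ((MultipartiteLOCC.localOp (⟨n - 1, by omega⟩ : Fin n) (Matrix.diagonal h)) *ᵥ
          MultipartiteLOCC.ghz n d) ↔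
      MultipartiteLOCC.Majorizes (fun i => ‖h i‖ ^ 2) (fun i => ‖g i‖ ^ 2) := by
  open MultipartiteLOCC in
  have hn0 : 0 < n := by omega
  have hg0 : ∀ i, g i ≠ 0 := fun i =>
    (Pi.isUnit_iff.1 (Matrix.isUnit_diagonal.1 hg) i).ne_zero
  have hh0 : ∀ i, h i ≠ 0 := fun i =>
    (Pi.isUnit_iff.1 (Matrix.isUnit_diagonal.1 hh) i).ne_zero
  have hgh : ∑ i, ‖g i‖ ^ 2 = ∑ i, ‖h i‖ ^ 2 := by
    simp only [Matrix.diagonal_conjTranspose, Matrix.diagonal_mul_diagonal, Matrix.trace_diagonal,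
      Pi.star_apply, RCLike.star_def, Complex.conj_mul'] at htr
    exact_mod_cast htr
  have hpos : 0 < ∑ i, ‖h i‖ ^ 2 :=
    Finset.sum_pos (fun i _ => by have := norm_pos_iff.2 (hh0 i); positivity)
      ⟨⟨0, hd⟩, Finset.mem_univ _⟩
  have hne : (((∑ i, ‖h i‖ ^ 2 : ℝ) : ℂ))⁻¹ ≠ 0 :=
    inv_ne_zero (Complex.ofReal_ne_zero.2 hpos.ne')
  rw [LOCCConvertible, pureState_localOp_mulVec_ghz hn0 hd, pureState_localOp_mulVec_ghz hn0 hd,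
    hgh]
  simp only [map_smul, smul_right_inj hne]
  constructor
  · rintro ⟨E, hE, hmap⟩
    refine ⟨fun k => ?_, by rw [sum_sortDesc, sum_sortDesc, hgh]⟩
    -- Take for S the positions of the k+1 largest |g_i|², k being counted from 0.
    have := hE.sum_norm_sq_le hn g h hgh hpos hmap k
      ((Finset.Iic k).map (descPerm fun i => ‖g i‖ ^ 2).toEmbedding) (by simp)
    rwa [Finset.sum_map] at this
  -- Any party may measure, since a diagonal operator acts on the GHZ state in the same way from
  -- every factor.
  · exact exists_isLOCC_of_majorizes ⟨0, hn0⟩ g h hg0 hpos.ne' hgh
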